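/- Let $n\ge 2$ and let $\mathcal M^n$ be the Euclidean space $\mathbb R^n$, the unit sphere $S^n$ or the hyperbolic space $H^n$, with geodesic distance $d$ and closed balls $B(z,r)=\{x\in\mathcal M^n: d(x,z)\le r\}$. A set $X\subset\mathcal M^n$ is convex if it contains the geodesic segment between any two of its points and, in the case $\mathcal M^n=S^n$, also lies in an open hemisphere. A convex body is a compact convex set with non-empty interior. A convex body $K$ is of constant width $D$ if $\operatorname{diam}K=D$ and, for every boundary point $p$ of $K$ and every exterior unit normal $v$ to $K$ at $p$ (that is, a unit tangent vector $v$ at $p$ such that $K$ lies in the closed half-space towards which $-v$ points and which is bounded by the hyperplane through $p$ orthogonal to $v$), the geodesic segment of length $D$ that starts at $p$ in the direction $-v$ is contained in $K$. For a convex body $K$, let $R(K)$ be its circumradius (the smallest radius of a ball containing $K$) and $r(K)$ its inradius (the largest radius of a ball contained in $K$). For $\varrho>0$ let $K^{(\varrho)}=\{z\in\mathcal M^n:\ \exists x\in K,\ d(x,z)\le\varrho\}$ be the parallel domain. Let $\varrho>0$ and $D>0$, where $D+2\varrho<\frac{\pi}{2}$ if $\mathcal M^n=S^n$. If $K\subset\mathcal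 M^n$ is a convex body of constant width $D$, then $K^{(\varrho)}$ is a convex body of constant width $D+2\varrho$, and $$R\left(K^{(\varrho)}\right)=R(K)+\varrho,\qquad r\left(K^{(\varrho)}\right)=r(K)+\varrho,\qquad K^{(\varrho)}=\bigcap_{x\in K}B(x,D+\varrho).$$ -/

import Mathlib

namespace ConstantWidth

/-- The three geometries of constant curvature `0`, `1` and `-1`. -/
inductive Geometry
  | euclidean
  | spherical
  | hyperbolic

/-- The dimension of the linear space in which the `n`-dimensional space of the given geometry
is realised: `n` for `ℝⁿ`, and `n + 1` for `Sⁿ` and `Hⁿ`. -/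
abbrev ambientDim : Geometry → ℕ → ℕ
  | .euclidean, n => n
  | .spherical, n => n + 1
  | .hyperbolic, n => n + 1

/-- The ambient linear space, `ℝⁿ` or `ℝⁿ⁺¹`. -/
abbrev Ambient (g : Geometry) (n : ℕ) : Type :=
  EuclideanSpace ℝ (Fin (ambientDim g n))

/-- The Lorentzian form `𝓑(x, y) = x₀ y₀ - ∑_{i ≥ 1} xᵢ yᵢ` on `ℝⁿ⁺¹`
(the distinguished unit vector `e` is the coordinate vector with index `0`). -/
noncomputable def lorentz {n : ℕ} (x y : EuclideanSpace ℝ (Fin (n + 1))) : ℝ :=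
  x 0 * y 0 - ∑ i : Fin n, x i.succ * y i.succ

/-- The point set of the space: all of `ℝⁿ`, the unit sphere `Sⁿ ⊂ ℝⁿ⁺¹`, or the upper sheet
`Hⁿ ⊂ ℝⁿ⁺¹` of the hyperboloid. -/
def carrier : (g : Geometry) → (n : ℕ) → Set (Ambient g n)
  | .euclidean, _ => Set.univ
  | .spherical, _ => {x | inner ℝ x x = (1 : ℝ)}
  | .hyperbolic, n => {x : EuclideanSpace ℝ (Fin (n + 1)) | lorentz x x = 1 ∧ 1 ≤ x 0}

/-- The space `ℝⁿ`, `Sⁿ` or `Hⁿ`, with the topology induced from the ambient linear space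
(which is also the topology of the geodesic distance). -/
abbrev Space (g : Geometry) (n : ℕ) : Type := carrier g n

/-- The geodesic distance, as a function of points of the ambient space. -/
noncomputable def ambientDist : (g : Geometry) → (n : ℕ) → Ambient g n → Ambient g n → ℝ
  | .euclidean, _, x, y => ‖x - y‖
  | .spherical, _, x, y => Real.arccos (inner ℝ x y)
  | .hyperbolic, n, x, y =>
      Real.arcosh (lorentz (n := n) x y)

/-- `v` is a unit vector of the tangent space `T_p`. On `Hⁿ` the scalar product of `T_p` is
`-𝓑`. -/
def IsUnitTangentAt : (g : Geometry) → (n : ℕ) → Ambient g n → Ambient g n → Prop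
  | .euclidean, _, _, v => inner ℝ v v = (1 : ℝ)
  | .spherical, _, p, v => inner ℝ p v = (0 : ℝ) ∧ inner ℝ v v = (1 : ℝ)
  | .hyperbolic, n, p, v => lorentz (n := n) p v = 0 ∧ -lorentz (n := n) v v = 1

/-- The point with parameter `t` of the unit speed geodesic that starts at `p` in the direction
of the unit tangent vector `v`. -/
noncomputable def geodesic : (g : Geometry) → (n : ℕ) → Ambient g n → Ambient g n → ℝ →
    Ambient g n
  | .euclidean, _, p, v, t => p + t • v
  | .spherical, _, p, v, t => Real.cos t • p + Real.sin t • v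
  | .hyperbolic, _, p, v, t => Real.cosh t • p + Real.sinh t • v

/-- The closed half-space bounded by the hyperplane through `p` orthogonal to `v ∈ T_p` whose
exterior normal at `p` is `v`, that is, the half-space towards which `-v` points. -/
def halfSpace : (g : Geometry) → (n : ℕ) → Ambient g n → Ambient g n → Set (Ambient g n)
  | .euclidean, _, p, v => {x | inner ℝ x v ≤ (inner ℝ p v : ℝ)}
  | .spherical, _, _, v => {x | inner ℝ x v ≤ (0 : ℝ)}
  | .hyperbolic, n, _, v => {x | -lorentz (n := n) x v ≤ 0}

/-- On the sphere: `X` lies in an open hemisphere. No condition for `ℝⁿ` and `Hⁿ`. -/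
def InOpenHemisphere : (g : Geometry) → (n : ℕ) → Set (Space g n) → Prop
  | .euclidean, _, _ => True
  | .spherical, _, X => ∃ u : Ambient .spherical _, ∀ x ∈ X, (0 : ℝ) < inner ℝ u x.1
  | .hyperbolic, _, _ => True

variable {g : Geometry} {n : ℕ}

/-- The geodesic distance of `ℝⁿ`, `Sⁿ` or `Hⁿ`. -/
noncomputable def gdist (x y : Space g n) : ℝ := ambientDist g n x.1 y.1

/-- The closed ball `B(z, r)` of the geodesic distance. -/
def gball (z : Space g n) (r : ℝ) : Set (Space g n) := {x | gdist x z ≤ r}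

/-- The diameter: the supremum of the geodesic distances of pairs of points. -/
noncomputable def gdiam (X : Set (Space g n)) : ℝ :=
  sSup {d | ∃ x ∈ X, ∃ y ∈ X, d = gdist x y}

/-- The parallel domain `X^(ρ)`. -/
def parallel (X : Set (Space g n)) (ρ : ℝ) : Set (Space g n) :=
  {z | ∃ x ∈ X, gdist x z ≤ ρ}

/-- The geodesic segment `[x, y]`: if `y` is reached from `x` along a unit speed geodesic at time
`t ≥ 0` (with `t < π` on the sphere), it consists of the points reached at the times in `[0, t]`.
Antipodal points of the sphere have no segment. -/
def gsegment (x y : Space g n) : Set (Space g n) :=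
  {z | ∃ (v : Ambient g n) (t : ℝ), IsUnitTangentAt g n x.1 v ∧ 0 ≤ t ∧
    (g = .spherical → t < Real.pi) ∧ y.1 = geodesic g n x.1 v t ∧
    ∃ s ∈ Set.Icc 0 t, z.1 = geodesic g n x.1 v s}

/-- Geodesic convexity; on the sphere a convex set has to lie in an open hemisphere. -/
def IsConvexSet (X : Set (Space g n)) : Prop :=
  (∀ x ∈ X, ∀ y ∈ X, gsegment x y ⊆ X) ∧ InOpenHemisphere g n X

/-- A convex body: a compact convex set with non-empty interior. -/
def IsConvexBody (K : Set (Space g n)) : Prop :=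
  IsCompact K ∧ IsConvexSet K ∧ (interior K).Nonempty

/-- `v` is an exterior unit normal to `K` at `p`: a unit tangent vector at `p` such that the
hyperplane through `p` orthogonal to `v` supports `K` and `-v` points towards the side of `K`. -/
def IsOuterUnitNormal (K : Set (Space g n)) (p : Space g n) (v : Ambient g n) : Prop :=
  IsUnitTangentAt g n p.1 v ∧ ∀ x ∈ K, x.1 ∈ halfSpace g n p.1 v

/-- `K` is a convex body of constant width `D`: its diameter is `D`, and from each boundary point
`p` and for each exterior unit normal `v` at `p`, the geodesic segment of length `D` starting at
`p` in the direction of `-v` is contained in `K`. -/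
def IsConvexBodyOfConstantWidth (K : Set (Space g n)) (D : ℝ) : Prop :=
  IsConvexBody K ∧ gdiam K = D ∧
    ∀ p ∈ frontier K, ∀ v : Ambient g n, IsOuterUnitNormal K p v →
      ∀ t ∈ Set.Icc 0 D, ∃ q ∈ K, q.1 = geodesic g n p.1 (-v) t

/-- The circumradius `R(K)`: the least radius of a ball containing `K`. -/
noncomputable def circumradius (K : Set (Space g n)) : ℝ :=
  sInf {r | 0 ≤ r ∧ ∃ z : Space g n, K ⊆ gball z r}

/-- The inradius `r(K)`: the largest radius of a ball contained in `K`. -/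
noncomputable def inradius (K : Set (Space g n)) : ℝ :=
  sSup {r | 0 ≤ r ∧ ∃ z : Space g n, gball z r ⊆ K}

end ConstantWidth

/-! The carrying fact is that, for `K` of constant width `D`, the parallel domain at distance `σ ≥
0` is the intersection of the balls `B(x, D + σ)`, `x ∈ K` (`exists_gdist_le`,
`parallel_eq_iInter`). Let `z ∉ K` lie in all these balls and let `p ∈ K` be nearest to `z`. By the
first variation of distance, the geodesic from `p` to `z` leaves `K` along an exterior normal, so
its backward prolongation by `D` stays in `K`. The far end has distance `D + d(p, z)` from `z`,
whence `d(p, z) ≤ σ`.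

Closedness, compactness and convexity of the parallel domain follow from those of balls. Its
diameter comes from prolonging a diametral segment at both ends. For the width condition, let `p` be
a boundary point of the parallel domain and `q ∈ K` nearest to it. The ball `B(q, ρ)` touches the
supporting hyperplane at `p`, so the inward normal passes through `q`, then runs inside `K` for
length `D`, and needs only a further `ρ`.

Both radii rest on `gdist_add_le_of_gball_subset`: a ball inside a ball forces an inequality between
radii and centre distance. The inradius also uses the case `σ = 0`, which writes `K` as an
intersection of balls of radius `D`. -/

namespace ConstantWidth

open Set Filter Topology

/-! ### The Lorentzian form and the hyperboloid. -/

section Lorentz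

variable {n : ℕ}

theorem lorentz_comm (x y : EuclideanSpace ℝ (Fin (n + 1))) : lorentz x y = lorentz y x := by
  simp only [lorentz, mul_comm]

theorem lorentz_add_left (x y z : EuclideanSpace ℝ (Fin (n + 1))) :
    lorentz (x + y) z = lorentz x z + lorentz y z := by
  simp only [lorentz, PiLp.add_apply, add_mul, Finset.sum_add_distrib]
  ring

theorem lorentz_smul_left (a : ℝ) (x y : EuclideanSpace ℝ (Fin (n + 1))) :
    lorentz (a • x) y = a * lorentz x y := by
  simp only [lorentz, PiLp.smul_apply, smul_eq_mul, mul_assoc, ← Finset.mul_sum]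
  ring

theorem lorentz_add_right (x y z : EuclideanSpace ℝ (Fin (n + 1))) :
    lorentz x (y + z) = lorentz x y + lorentz x z := by
  rw [lorentz_comm, lorentz_add_left, lorentz_comm y, lorentz_comm z]

theorem lorentz_smul_right (a : ℝ) (x y : EuclideanSpace ℝ (Fin (n + 1))) :
    lorentz x (a • y) = a * lorentz x y := by
  rw [lorentz_comm, lorentz_smul_left, lorentz_comm]

theorem continuous_lorentz :
    Continuous fun p : EuclideanSpace ℝ (Fin (n + 1)) × EuclideanSpace ℝ (Fin (n + 1)) =>
      lorentz p.1 p.2 := by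
  unfold lorentz
  fun_prop

/-- On the orthogonal complement of a timelike unit vector the Lorentzian form is negative
definite. -/
theorem lorentz_self_bound {p v : EuclideanSpace ℝ (Fin (n + 1))} (hp : lorentz p p = 1)
    (h : lorentz p v = 0) : ∑ i : Fin n, v i.succ ^ 2 ≤ p 0 ^ 2 * -lorentz v v := by
  have hcs := Finset.sum_mul_sq_le_sq_mul_sq Finset.univ (fun i : Fin n => p i.succ)
    (fun i : Fin n => v i.succ)
  simp only [lorentz, ← pow_two] at *
  have h1 : ∑ i : Fin n, p i.succ * v i.succ = p 0 * v 0 := by linarith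
  have h2 : ∑ i : Fin n, p i.succ ^ 2 = p 0 ^ 2 - 1 := by linarith
  -- Cauchy–Schwarz becomes `p₀² v₀² ≤ (p₀² - 1) ∑ vᵢ²`, a rearrangement of the goal.
  rw [h1, h2] at hcs
  nlinarith

theorem lorentz_self_nonpos {p v : EuclideanSpace ℝ (Fin (n + 1))} (hp : lorentz p p = 1)
    (hp0 : 1 ≤ p 0) (h : lorentz p v = 0) : lorentz v v ≤ 0 := by
  have h1 := lorentz_self_bound hp h
  have h2 : 0 ≤ ∑ i : Fin n, v i.succ ^ 2 := Finset.sum_nonneg fun i _ => sq_nonneg _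
  have h3 : 0 < p 0 ^ 2 := by positivity
  by_contra h4
  nlinarith

theorem eq_zero_of_lorentz_self_eq_zero {p v : EuclideanSpace ℝ (Fin (n + 1))}
    (hp : lorentz p p = 1) (hp0 : 1 ≤ p 0) (h : lorentz p v = 0) (hv : lorentz v v = 0) :
    v = 0 := by
  have h1 := lorentz_self_bound hp h
  rw [hv, neg_zero, mul_zero] at h1
  have h2 : ∑ i : Fin n, v i.succ ^ 2 = 0 :=
    le_antisymm h1 (Finset.sum_nonneg fun i _ => sq_nonneg _)
  have h3 := (Finset.sum_eq_zero_iff_of_nonneg fun i _ => sq_nonneg _).1 h2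
  have h4 : ∀ i : Fin n, v i.succ = 0 := fun i => pow_eq_zero_iff two_ne_zero |>.1 (h3 i (by simp))
  simp only [lorentz, h4, mul_zero, Finset.sum_const_zero, sub_zero] at h
  ext i
  refine Fin.cases ?_ (fun i => h4 i) i
  rcases mul_eq_zero.1 h with h | h
  · linarith
  · exact h

/-- Reversed Cauchy–Schwarz inequality on the upper sheet of the hyperboloid. -/
theorem one_le_lorentz {x y : EuclideanSpace ℝ (Fin (n + 1))} (hx : lorentz x x = 1)
    (hx0 : 1 ≤ x 0) (hy : lorentz y y = 1) (hy0 : 1 ≤ y 0) : 1 ≤ lorentz x y := by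
  have h1 : lorentz x (y + (-lorentz x y) • x) = 0 := by
    rw [lorentz_add_right, lorentz_smul_right, hx]; ring
  have h2 := lorentz_self_nonpos hx hx0 h1
  simp only [lorentz_add_right, lorentz_smul_right, lorentz_add_left, lorentz_smul_left, hx, hy,
    lorentz_comm y x] at h2
  -- `h2` only gives `1 ≤ 𝓑(x, y)²`; lying on the upper sheet fixes the sign.
  have h3 : 0 < lorentz x y := by
    have hcs := Finset.sum_mul_sq_le_sq_mul_sq Finset.univ (fun i : Fin n => x i.succ)
      (fun i : Fin n => y i.succ)
    simp only [lorentz, ← pow_two] at hx hy ⊢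
    have e1 : ∑ i : Fin n, x i.succ ^ 2 = x 0 ^ 2 - 1 := by linarith
    have e2 : ∑ i : Fin n, y i.succ ^ 2 = y 0 ^ 2 - 1 := by linarith
    rw [e1, e2] at hcs
    have : ∑ i : Fin n, x i.succ * y i.succ < x 0 * y 0 := by
      refine lt_of_pow_lt_pow_left₀ 2 (by positivity) (hcs.trans_lt ?_)
      nlinarith
    linarith
  nlinarith

end Lorentz

/-! ### Tangent spaces, uniformly in the three geometries. -/

/-- The bilinear form that induces the scalar products of the tangent spaces. -/
noncomputable def tform : (g : Geometry) → (n : ℕ) → Ambient g n → Ambient g n → ℝ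
  | .euclidean, _, x, y => inner ℝ x y
  | .spherical, _, x, y => inner ℝ x y
  | .hyperbolic, n, x, y => -lorentz (n := n) x y

/-- `v` is a tangent vector at `p`. -/
def IsTangent : (g : Geometry) → (n : ℕ) → Ambient g n → Ambient g n → Prop
  | .euclidean, _, _, _ => True
  | .spherical, _, p, v => inner ℝ p v = (0 : ℝ)
  | .hyperbolic, n, p, v => lorentz (n := n) p v = 0

/-- The velocity at time `t` of the geodesic that starts at `p` in the direction `v`. -/
noncomputable def velocity : (g : Geometry) → (n : ℕ) → Ambient g n → Ambient g n → ℝ →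
    Ambient g n
  | .euclidean, _, _, v, _ => v
  | .spherical, _, p, v, t => -Real.sin t • p + Real.cos t • v
  | .hyperbolic, _, p, v, t => Real.sinh t • p + Real.cosh t • v

variable {g : Geometry} {n : ℕ}

theorem isUnitTangentAt_iff {p v : Ambient g n} :
    IsUnitTangentAt g n p v ↔ IsTangent g n p v ∧ tform g n v v = 1 := by
  cases g <;> simp [IsUnitTangentAt, IsTangent, tform]

theorem tform_comm (x y : Ambient g n) : tform g n x y = tform g n y x := by
  cases g
  · exact real_inner_comm _ _
  · exact real_inner_comm _ _
  · exact congrArg Neg.neg (lorentz_comm _ _)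

theorem tform_add_left (x y z : Ambient g n) :
    tform g n (x + y) z = tform g n x z + tform g n y z := by
  cases g
  · exact inner_add_left _ _ _
  · exact inner_add_left _ _ _
  · simp only [tform, lorentz_add_left]; ring

theorem tform_smul_left (a : ℝ) (x y : Ambient g n) :
    tform g n (a • x) y = a * tform g n x y := by
  cases g
  · exact real_inner_smul_left _ _ _
  · exact real_inner_smul_left _ _ _
  · simp only [tform, lorentz_smul_left]; ring

theorem tform_add_right (x y z : Ambient g n) :
    tform g n x (y + z) = tform g n x y + tform g n x z := by
  rw [tform_comm, tform_add_left, tform_comm y, tform_comm z]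

theorem tform_smul_right (a : ℝ) (x y : Ambient g n) :
    tform g n x (a • y) = a * tform g n x y := by
  rw [tform_comm, tform_smul_left, tform_comm]

theorem tform_neg_left (x y : Ambient g n) : tform g n (-x) y = -tform g n x y := by
  rw [← neg_one_smul ℝ x, tform_smul_left]; ring

theorem tform_neg_right (x y : Ambient g n) : tform g n x (-y) = -tform g n x y := by
  rw [tform_comm, tform_neg_left, tform_comm]

theorem IsTangent.add {p v w : Ambient g n} (hv : IsTangent g n p v) (hw : IsTangent g n p w) :
    IsTangent g n p (v + w) := by
  cases g
  · trivial
  · simp only [IsTangent] at *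
    rw [inner_add_right, hv, hw, add_zero]
  · simp only [IsTangent] at *
    rw [lorentz_add_right, hv, hw, add_zero]

theorem IsTangent.smul {p v : Ambient g n} (a : ℝ) (hv : IsTangent g n p v) :
    IsTangent g n p (a • v) := by
  cases g
  · trivial
  · simp only [IsTangent] at *
    rw [real_inner_smul_right, hv, mul_zero]
  · simp only [IsTangent] at *
    rw [lorentz_smul_right, hv, mul_zero]

theorem IsTangent.tform_nonneg {p : Space g n} {v : Ambient g n} (hv : IsTangent g n p.1 v) :
    0 ≤ tform g n v v := by
  cases g
  · exact real_inner_self_nonneg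
  · exact real_inner_self_nonneg
  · exact neg_nonneg.2 (lorentz_self_nonpos p.2.1 p.2.2 hv)

theorem IsTangent.eq_zero {p : Space g n} {v : Ambient g n} (hv : IsTangent g n p.1 v)
    (h : tform g n v v = 0) : v = 0 := by
  cases g
  · exact inner_self_eq_zero.1 h
  · exact inner_self_eq_zero.1 h
  · exact eq_zero_of_lorentz_self_eq_zero p.2.1 p.2.2 hv (neg_eq_zero.1 h)

theorem IsUnitTangentAt.neg {p v : Ambient g n} (hv : IsUnitTangentAt g n p v) :
    IsUnitTangentAt g n p (-v) := by
  rw [isUnitTangentAt_iff] at *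
  refine ⟨?_, ?_⟩
  · simpa using hv.1.smul (-1)
  · rw [tform_neg_left, tform_neg_right, neg_neg, hv.2]

theorem isUnitTangentAt_normalize {p : Space g n} {v : Ambient g n} (hv : IsTangent g n p.1 v)
    (h : 0 < tform g n v v) : IsUnitTangentAt g n p.1 ((√(tform g n v v))⁻¹ • v) := by
  rw [isUnitTangentAt_iff]
  refine ⟨hv.smul _, ?_⟩
  rw [tform_smul_left, tform_smul_right, ← mul_assoc, ← mul_inv, Real.mul_self_sqrt h.le,
    inv_mul_cancel₀ h.ne']

/-- A single linear functional on a space of dimension at least 2 has a nonzero kernel. This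
supplies a direction where two points determine none. -/
theorem exists_isUnitTangentAt (hn : 2 ≤ n) (p : Space g n) :
    ∃ v, IsUnitTangentAt g n p.1 v := by
  have key : ∃ v : Ambient g n, v ≠ 0 ∧ tform g n p.1 v = 0 := by
    let f : Ambient g n →ₗ[ℝ] ℝ :=
      { toFun := fun v => tform g n p.1 v
        map_add' := fun x y => tform_add_right _ _ _
        map_smul' := fun a x => tform_smul_right _ _ _ }
    have hf : LinearMap.ker f ≠ ⊥ := by
      apply LinearMap.ker_ne_bot_of_finrank_lt
      rw [finrank_euclideanSpace_fin, Module.finrank_self]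
      cases g <;> simp only [ambientDim] <;> omega
    obtain ⟨v, hv, hv0⟩ := Submodule.exists_mem_ne_zero_of_ne_bot hf
    exact ⟨v, hv0, hv⟩
  obtain ⟨v, hv0, hv⟩ := key
  have ht : IsTangent g n p.1 v := by
    cases g
    · trivial
    · exact hv
    · exact neg_eq_zero.1 hv
  exact ⟨_, isUnitTangentAt_normalize ht (lt_of_le_of_ne ht.tform_nonneg
    fun h => hv0 (ht.eq_zero h.symm))⟩

theorem tform_add_self {p : Space g n} {v w : Ambient g n} (hv : IsUnitTangentAt g n p.1 v)
    (hw : IsUnitTangentAt g n p.1 w) : tform g n (v + w) (v + w) = 2 + 2 * tform g n v w := by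
  rw [isUnitTangentAt_iff] at *
  rw [tform_add_left, tform_add_right, tform_add_right, hv.2, hw.2, tform_comm w v]
  ring

theorem neg_one_le_tform {p : Space g n} {v w : Ambient g n} (hv : IsUnitTangentAt g n p.1 v)
    (hw : IsUnitTangentAt g n p.1 w) : -1 ≤ tform g n v w := by
  have h := ((isUnitTangentAt_iff.1 hv).1.add (isUnitTangentAt_iff.1 hw).1).tform_nonneg
  rw [tform_add_self hv hw] at h
  linarith

/-- Two distinct non-opposite unit tangent vectors have a common acute direction. -/
theorem exists_acute {p : Space g n} {v w : Ambient g n} (hv : IsUnitTangentAt g n p.1 v)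
    (hw : IsUnitTangentAt g n p.1 w) (hne : w ≠ -v) :
    ∃ u, IsUnitTangentAt g n p.1 u ∧ 0 < tform g n u v ∧ 0 < tform g n u w := by
  have ht := (isUnitTangentAt_iff.1 hv).1.add (isUnitTangentAt_iff.1 hw).1
  have hpos : 0 < tform g n (v + w) (v + w) := lt_of_le_of_ne ht.tform_nonneg fun h =>
    hne (eq_neg_of_add_eq_zero_right (ht.eq_zero h.symm))
  have hc : 0 < 1 + tform g n v w := by
    have := tform_add_self hv hw
    linarith
  refine ⟨_, isUnitTangentAt_normalize ht hpos, ?_, ?_⟩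
  · rw [tform_smul_left]
    refine mul_pos (inv_pos.2 (Real.sqrt_pos.2 hpos)) ?_
    rwa [tform_add_left, (isUnitTangentAt_iff.1 hv).2, tform_comm w v]
  · rw [tform_smul_left]
    refine mul_pos (inv_pos.2 (Real.sqrt_pos.2 hpos)) ?_
    rwa [tform_add_left, (isUnitTangentAt_iff.1 hw).2, add_comm]

/-! ### Geodesics. -/

theorem geodesic_zero (p v : Ambient g n) : geodesic g n p v 0 = p := by
  cases g <;> simp [geodesic]

theorem geodesic_neg (p v : Ambient g n) (t : ℝ) :
    geodesic g n p (-v) t = geodesic g n p v (-t) := by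
  cases g <;> simp [geodesic]

theorem geodesic_geodesic (p v : Ambient g n) (s t : ℝ) :
    geodesic g n (geodesic g n p v s) (velocity g n p v s) t = geodesic g n p v (s + t) := by
  cases g
  · simp only [geodesic, velocity]; module
  · simp only [geodesic, velocity, Real.cos_add, Real.sin_add]; module
  · simp only [geodesic, velocity, Real.cosh_add, Real.sinh_add]; module

theorem continuous_geodesic (p v : Ambient g n) : Continuous (geodesic g n p v) := by
  cases g <;> unfold geodesic <;> fun_prop

theorem geodesic_mem_carrier (p : Space g n) {v : Ambient g n} (hv : IsUnitTangentAt g n p.1 v)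
    (t : ℝ) : geodesic g n p.1 v t ∈ carrier g n := by
  cases g
  · trivial
  · obtain ⟨h1, h2⟩ := hv
    have hp : inner ℝ p.1 p.1 = (1 : ℝ) := p.2
    simp only [geodesic, carrier, mem_ofPred_eq, inner_add_left, inner_add_right,
      real_inner_smul_left, real_inner_smul_right, h1, h2, hp, real_inner_comm p.1 v]
    nlinarith [Real.sin_sq_add_cos_sq t]
  · obtain ⟨h1, h2⟩ := hv
    obtain ⟨hp, hp0⟩ := p.2
    have h3 : lorentz v v = -1 := by linarith
    have h4 : lorentz (geodesic .hyperbolic n p.1 v t) (geodesic .hyperbolic n p.1 v t) = 1 := by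
      simp only [geodesic, lorentz_add_left, lorentz_add_right, lorentz_smul_left,
        lorentz_smul_right, h1, h3, hp, lorentz_comm v p.1]
      nlinarith [Real.cosh_sq t]
    refine ⟨h4, ?_⟩
    -- This yields `|v₀| ≤ p₀`; since `|sinh t| < cosh t`, the geodesic stays on the upper sheet.
    have hb := lorentz_self_bound hp h1
    rw [h2, mul_one] at hb
    have h5 : v 0 ^ 2 ≤ p.1 0 ^ 2 := by
      simp only [lorentz, ← pow_two] at h3
      linarith
    have h6 := abs_le.1 (abs_le_of_sq_le_sq h5 (by linarith))
    have hpos : 0 < geodesic .hyperbolic n p.1 v t 0 := by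
      simp only [geodesic, PiLp.add_apply, PiLp.smul_apply, smul_eq_mul]
      rw [Real.cosh_eq, Real.sinh_eq]
      have e1 := Real.exp_pos t
      have e2 := Real.exp_pos (-t)
      rcases lt_or_ge (v 0) 0 with hneg | hneg
      · nlinarith
      · nlinarith
    have hs : 0 ≤ ∑ i : Fin n, geodesic .hyperbolic n p.1 v t i.succ *
        geodesic .hyperbolic n p.1 v t i.succ := Finset.sum_nonneg fun i _ => mul_self_nonneg _
    simp only [lorentz] at h4
    nlinarith

/-- The point with parameter `t` of a geodesic. -/
noncomputable def geoPoint (p : Space g n) (v : Ambient g n) (hv : IsUnitTangentAt g n p.1 v)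
    (t : ℝ) : Space g n := ⟨geodesic g n p.1 v t, geodesic_mem_carrier p hv t⟩

theorem isUnitTangentAt_velocity (p : Space g n) {v : Ambient g n}
    (hv : IsUnitTangentAt g n p.1 v) (t : ℝ) :
    IsUnitTangentAt g n (geodesic g n p.1 v t) (velocity g n p.1 v t) := by
  cases g
  · exact hv
  · obtain ⟨h1, h2⟩ := hv
    have hp : inner ℝ p.1 p.1 = (1 : ℝ) := p.2
    simp only [geodesic, velocity, IsUnitTangentAt, inner_add_left, inner_add_right,
      real_inner_smul_left, real_inner_smul_right, h1, h2, hp, real_inner_comm p.1 v]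
    constructor
    · ring
    · nlinarith [Real.sin_sq_add_cos_sq t]
  · obtain ⟨h1, h2⟩ := hv
    obtain ⟨hp, hp0⟩ := p.2
    have h3 : lorentz v v = -1 := by linarith
    simp only [geodesic, velocity, IsUnitTangentAt, lorentz_add_left, lorentz_add_right,
      lorentz_smul_left, lorentz_smul_right, h1, h3, hp, lorentz_comm v p.1]
    constructor
    · ring
    · nlinarith [Real.cosh_sq t]

/-! ### The geodesic distance. -/

theorem norm_eq_one_of_spherical (x : Space .spherical n) : ‖x.1‖ = 1 := by
  have h : inner ℝ x.1 x.1 = (1 : ℝ) := x.2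
  rw [real_inner_self_eq_norm_sq] at h
  exact (pow_eq_one_iff_of_nonneg (norm_nonneg _) two_ne_zero).1 h

theorem abs_inner_le_one_of_spherical (x y : Space .spherical n) :
    |(inner ℝ x.1 y.1 : ℝ)| ≤ 1 := by
  have h := abs_real_inner_le_norm x.1 y.1
  rwa [norm_eq_one_of_spherical x, norm_eq_one_of_spherical y, mul_one] at h

theorem cos_gdist (x y : Space .spherical n) : Real.cos (gdist x y) = inner ℝ x.1 y.1 :=
  have h := abs_le.1 (abs_inner_le_one_of_spherical x y)
  Real.cos_arccos h.1 h.2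

theorem one_le_lorentz_coe (x y : Space .hyperbolic n) : 1 ≤ lorentz (n := n) x.1 y.1 :=
  one_le_lorentz x.2.1 x.2.2 y.2.1 y.2.2

theorem cosh_gdist (x y : Space .hyperbolic n) :
    Real.cosh (gdist x y) = lorentz (n := n) x.1 y.1 :=
  Real.cosh_arcosh (one_le_lorentz_coe x y)

theorem gdist_nonneg (x y : Space g n) : 0 ≤ gdist x y := by
  cases g
  · exact norm_nonneg _
  · exact Real.arccos_nonneg _
  · exact Real.arcosh_nonneg (one_le_lorentz_coe x y)

theorem gdist_le_pi (x y : Space .spherical n) : gdist x y ≤ Real.pi :=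
  Real.arccos_le_pi _

theorem gdist_comm (x y : Space g n) : gdist x y = gdist y x := by
  cases g
  · exact norm_sub_rev _ _
  · exact congrArg Real.arccos (real_inner_comm _ _)
  · exact congrArg Real.arcosh (lorentz_comm _ _)

theorem gdist_self (x : Space g n) : gdist x x = 0 := by
  cases g
  · simp [gdist, ambientDist]
  · have h : inner ℝ x.1 x.1 = (1 : ℝ) := x.2
    simp only [gdist, ambientDist, h, Real.arccos_one]
  · have h : lorentz (n := n) x.1 x.1 = 1 := x.2.1
    simp only [gdist, ambientDist, h, Real.arcosh_zero]

theorem continuous_gdist : Continuous fun p : Space g n × Space g n => gdist p.1 p.2 := by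
  cases g
  · simp only [gdist, ambientDist]; fun_prop
  · simp only [gdist, ambientDist]
    exact Real.continuous_arccos.comp (by fun_prop)
  · exact Real.continuousOn_arcosh.comp_continuous
      (continuous_lorentz.comp (by fun_prop : Continuous
        fun p : Space .hyperbolic n × Space .hyperbolic n => (p.1.1, p.2.1)))
      fun p => one_le_lorentz_coe p.1 p.2

theorem gdist_geoPoint (p : Space g n) {v : Ambient g n} (hv : IsUnitTangentAt g n p.1 v)
    {s t : ℝ} (hst : s ≤ t) (hpi : g = .spherical → t - s ≤ Real.pi) :
    gdist (geoPoint p v hv s) (geoPoint p v hv t) = t - s := by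
  cases g
  · simp only [gdist, ambientDist, geoPoint, geodesic]
    have h1 : ‖v‖ = 1 := by
      have h : inner ℝ v v = (1 : ℝ) := hv
      rw [real_inner_self_eq_norm_sq] at h
      exact (pow_eq_one_iff_of_nonneg (norm_nonneg _) two_ne_zero).1 h
    rw [add_sub_add_left_eq_sub, ← sub_smul, norm_smul, h1, mul_one, Real.norm_eq_abs,
      abs_sub_comm, abs_of_nonneg (sub_nonneg.2 hst)]
  · have h : (inner ℝ (geodesic .spherical n p.1 v s) (geodesic .spherical n p.1 v t) : ℝ) =
        Real.cos (t - s) := by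
      obtain ⟨h1, h2⟩ := hv
      have hp : inner ℝ p.1 p.1 = (1 : ℝ) := p.2
      simp only [geodesic, inner_add_left, inner_add_right,
        real_inner_smul_left, real_inner_smul_right, h1, h2, hp, real_inner_comm p.1 v,
        Real.cos_sub]
      ring
    simp only [gdist, ambientDist, geoPoint, h]
    exact Real.arccos_cos (sub_nonneg.2 hst) (hpi rfl)
  · have h : lorentz (geodesic .hyperbolic n p.1 v s) (geodesic .hyperbolic n p.1 v t) =
        Real.cosh (t - s) := by
      obtain ⟨h1, h2⟩ := hv
      have hp : lorentz (n := n) p.1 p.1 = 1 := p.2.1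
      have h3 : lorentz v v = -1 := by linarith
      simp only [geodesic, lorentz_add_left, lorentz_add_right, lorentz_smul_left,
        lorentz_smul_right, h1, h3, hp, lorentz_comm v p.1, Real.cosh_sub]
      ring
    simp only [gdist, ambientDist, geoPoint, h]
    exact Real.arcosh_cosh (sub_nonneg.2 hst)

theorem geoPoint_zero (p : Space g n) {v : Ambient g n} (hv : IsUnitTangentAt g n p.1 v) :
    geoPoint p v hv 0 = p := Subtype.ext (geodesic_zero _ _)

theorem gdist_geoPoint_right (p : Space g n) {v : Ambient g n}
    (hv : IsUnitTangentAt g n p.1 v) {t : ℝ} (ht : 0 ≤ t) (hpi : g = .spherical → t ≤ Real.pi) :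
    gdist p (geoPoint p v hv t) = t := by
  have h := gdist_geoPoint p hv ht (by simpa using hpi)
  rwa [geoPoint_zero, sub_zero] at h

/-- Any two points are joined by a geodesic whose length is their distance. -/
theorem exists_geodesic (hn : 2 ≤ n) (x y : Space g n) :
    ∃ v, IsUnitTangentAt g n x.1 v ∧ y.1 = geodesic g n x.1 v (gdist x y) := by
  have aux : ∀ (a b : ℝ) (w : Ambient g n), IsTangent g n x.1 w → 0 ≤ b →
      tform g n w w = b ^ 2 → y.1 = a • x.1 + w →
      ∃ v, IsUnitTangentAt g n x.1 v ∧ y.1 = a • x.1 + b • v := by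
    intro a b w hw hb hwb hy
    -- If `b = 0` the tangential part vanishes (coincident or antipodal points), and any direction
    -- serves.
    rcases hb.eq_or_lt with rfl | hb
    · obtain ⟨v, hv⟩ := exists_isUnitTangentAt hn x
      exact ⟨v, hv, by rw [hy, hw.eq_zero (by simpa using hwb)]; simp⟩
    · refine ⟨b⁻¹ • w, isUnitTangentAt_iff.2 ⟨hw.smul _, ?_⟩, ?_⟩
      · rw [tform_smul_left, tform_smul_right, hwb]; field_simp
      · rw [hy, smul_inv_smul₀ hb.ne']
  cases g
  · obtain ⟨v, hv, h⟩ := aux 1 (gdist x y) (y.1 - x.1) trivial (gdist_nonneg _ _)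
      (by rw [gdist_comm]; exact real_inner_self_eq_norm_sq _) (by simp)
    exact ⟨v, hv, by simpa [geodesic] using h⟩
  · have hx : inner ℝ x.1 x.1 = (1 : ℝ) := x.2
    have hy : inner ℝ y.1 y.1 = (1 : ℝ) := y.2
    refine aux (Real.cos (gdist x y)) (Real.sin (gdist x y))
      (y.1 - Real.cos (gdist x y) • x.1) ?_
      (Real.sin_nonneg_of_nonneg_of_le_pi (gdist_nonneg _ _) (gdist_le_pi _ _)) ?_ (by simp)
    · simp only [IsTangent, inner_sub_right, real_inner_smul_right, hx, cos_gdist]; ring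
    · simp only [tform, inner_sub_right, inner_sub_left, real_inner_smul_right,
        real_inner_smul_left, hx, hy, Real.sin_sq, cos_gdist, real_inner_comm x.1 y.1]
      ring
  · have hx : lorentz (n := n) x.1 x.1 = 1 := x.2.1
    have hy : lorentz (n := n) y.1 y.1 = 1 := y.2.1
    refine aux (Real.cosh (gdist x y)) (Real.sinh (gdist x y))
      (y.1 + (-Real.cosh (gdist x y)) • x.1) ?_
      (Real.sinh_nonneg_iff.2 (gdist_nonneg _ _)) ?_ (by simp)
    · simp only [IsTangent, lorentz_add_right, lorentz_smul_right, hx, cosh_gdist]; ring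
    · simp only [tform, lorentz_add_right, lorentz_add_left, lorentz_smul_right,
        lorentz_smul_left, hx, hy, Real.sinh_sq, cosh_gdist, lorentz_comm y.1 x.1]
      ring

theorem exists_geoPoint (hn : 2 ≤ n) (x y : Space g n) :
    ∃ v, ∃ hv : IsUnitTangentAt g n x.1 v, y = geoPoint x v hv (gdist x y) := by
  obtain ⟨v, hv, h⟩ := exists_geodesic hn x y
  exact ⟨v, hv, Subtype.ext h⟩

theorem eq_of_gdist_eq_zero (hn : 2 ≤ n) {x y : Space g n} (h : gdist x y = 0) : x = y := by
  obtain ⟨v, hv, hy⟩ := exists_geoPoint hn x y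
  rw [hy, h, geoPoint_zero]

/-- In `Hⁿ`, with `v`, `w` the directions from `y` to `x` and `z` and `a`, `b` the distances, `cosh
d(x, z) = cosh a cosh b + sinh a sinh b 𝓑(v, w)`. Since `𝓑(v, w) ≤ 1`, this is at most `cosh (a +
b)`. -/
theorem gdist_triangle (hn : 2 ≤ n) (x y z : Space g n) :
    gdist x z ≤ gdist x y + gdist y z := by
  cases g
  · exact norm_sub_le_norm_sub_add_norm_sub _ _ _
  · have h := InnerProductGeometry.angle_le_angle_add_angle x.1 y.1 z.1
    simp only [InnerProductGeometry.angle] at h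
    rwa [norm_eq_one_of_spherical x, norm_eq_one_of_spherical y, norm_eq_one_of_spherical z,
      mul_one, div_one, div_one, div_one] at h
  · obtain ⟨v, hv, hx⟩ := exists_geodesic hn y x
    obtain ⟨w, hw, hz⟩ := exists_geodesic hn y z
    rw [gdist_comm x y]
    have hs := add_nonneg (gdist_nonneg y x) (gdist_nonneg y z)
    rw [← abs_of_nonneg (gdist_nonneg x z), ← abs_of_nonneg hs, ← Real.cosh_le_cosh, cosh_gdist,
      hx, hz, Real.cosh_add]
    have hy : lorentz (n := n) y.1 y.1 = 1 := y.2.1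
    have hc := neg_one_le_tform hv hw
    simp only [tform] at hc
    simp only [geodesic, lorentz_add_left, lorentz_add_right, lorentz_smul_left,
        lorentz_smul_right, hy, lorentz_comm v y.1, hv.1, hw.1]
    have h1 := mul_nonneg (Real.sinh_nonneg_iff.2 (gdist_nonneg y x))
      (Real.sinh_nonneg_iff.2 (gdist_nonneg y z))
    nlinarith

/-! ### First variation and half-spaces. -/

/-- First variation of the distance: moving in an acute direction brings us closer. -/
theorem eventually_gdist_lt {p : Space g n} {v w : Ambient g n}
    (hv : IsUnitTangentAt g n p.1 v) (hw : IsUnitTangentAt g n p.1 w)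
    (hc : 0 < tform g n w v) {t : ℝ} (ht : 0 < t) (hpi : g = .spherical → t < Real.pi) :
    ∀ᶠ s in 𝓝[>] 0, gdist (geoPoint p w hw s) (geoPoint p v hv t) < t := by
  -- In the curved cases this is applied to `cos` and `-cosh` of the distance, so that `arccos` and
  -- `arcosh` need no differentiation.
  have aux : ∀ (f : ℝ → ℝ) (a : ℝ), HasDerivAt f a 0 → 0 < a → ∀ᶠ s in 𝓝[>] 0, f 0 < f s := by
    intro f a hf ha
    have h1 : Tendsto (slope f 0) (𝓝[>] 0) (𝓝 a) :=
      (hasDerivAt_iff_tendsto_slope.1 hf).mono_left (nhdsWithin_mono _ fun x hx => ne_of_gt hx)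
    filter_upwards [h1.eventually (lt_mem_nhds ha), self_mem_nhdsWithin] with s hs hs0
    rw [slope_def_field, sub_zero] at hs
    exact sub_pos.1 ((div_pos_iff_of_pos_right hs0).1 hs)
  cases g
  -- `‖s w - t v‖² < t²` holds for exactly those `s > 0` with `s < 2 t ⟨w, v⟩`.
  · filter_upwards [self_mem_nhdsWithin,
      mem_nhdsWithin_of_mem_nhds (Iio_mem_nhds (by positivity : (0 : ℝ) < 2 * t * tform _ n w v))]
      with s (hs : 0 < s) (hs2 : s < _)
    have h2 : ‖geodesic .euclidean n p.1 w s - geodesic .euclidean n p.1 v t‖ ^ 2 < t ^ 2 := by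
      have e1 : inner ℝ v v = (1 : ℝ) := hv
      have e2 : inner ℝ w w = (1 : ℝ) := hw
      rw [← real_inner_self_eq_norm_sq]
      simp only [geodesic, add_sub_add_left_eq_sub, inner_sub_left, inner_sub_right,
        real_inner_smul_left, real_inner_smul_right, e1, e2, real_inner_comm w v]
      simp only [tform] at hs2
      nlinarith
    exact lt_of_pow_lt_pow_left₀ 2 ht.le h2
  · have hst := Real.sin_pos_of_pos_of_lt_pi ht (hpi rfl)
    have hd : HasDerivAt (fun s => Real.cos s * Real.cos t +
        Real.sin s * (Real.sin t * tform _ n w v)) (Real.sin t * tform _ n w v) 0 := by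
      have := ((Real.hasDerivAt_cos 0).mul_const (Real.cos t)).add
        ((Real.hasDerivAt_sin 0).mul_const (Real.sin t * tform _ n w v))
      exact this.congr_deriv (by simp)
    filter_upwards [aux _ _ hd (mul_pos hst hc)] with s hs
    have hp : inner ℝ p.1 p.1 = (1 : ℝ) := p.2
    have h : Real.cos t < Real.cos (gdist (geoPoint p w hw s) (geoPoint p v hv t)) := by
      rw [cos_gdist]
      simp only [geoPoint, geodesic, inner_add_left, inner_add_right,
        real_inner_smul_left, real_inner_smul_right, hv.1, hp, real_inner_comm p.1 w, hw.1]
      simp only [tform, Real.cos_zero, Real.sin_zero] at hs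
      linarith
    by_contra hle
    exact h.not_ge (Real.cos_le_cos_of_nonneg_of_le_pi ht.le (gdist_le_pi _ _) (not_lt.1 hle))
  · have hst := Real.sinh_pos_iff.2 ht
    have hd : HasDerivAt (fun s => -(Real.cosh s * Real.cosh t) +
        Real.sinh s * (Real.sinh t * tform _ n w v)) (Real.sinh t * tform _ n w v) 0 := by
      have := ((Real.hasDerivAt_cosh 0).mul_const (Real.cosh t)).neg.add
        ((Real.hasDerivAt_sinh 0).mul_const (Real.sinh t * tform _ n w v))
      exact this.congr_deriv (by simp)
    filter_upwards [aux _ _ hd (mul_pos hst hc)] with s hs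
    have hp : lorentz (n := n) p.1 p.1 = 1 := p.2.1
    have h : Real.cosh (gdist (geoPoint p w hw s) (geoPoint p v hv t)) < Real.cosh t := by
      rw [cosh_gdist]
      simp only [geoPoint, geodesic, lorentz_add_left, lorentz_add_right, lorentz_smul_left,
        lorentz_smul_right, hp, lorentz_comm w p.1, hv.1, hw.1]
      simp only [tform, Real.cosh_zero, Real.sinh_zero] at hs
      linarith
    rwa [Real.cosh_lt_cosh, abs_of_nonneg (gdist_nonneg _ _), abs_of_pos ht] at h

/-- The condition for membership reduces to the sign of `tform g n w v` times `t`, `sin t` or `sinh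
t`; the bound `t < π` keeps the sine positive. -/
theorem geodesic_mem_halfSpace_iff {p : Space g n} {v w : Ambient g n}
    (hv : IsUnitTangentAt g n p.1 v) {t : ℝ} (ht : 0 < t)
    (hpi : g = .spherical → t < Real.pi) :
    geodesic g n p.1 w t ∈ halfSpace g n p.1 v ↔ tform g n w v ≤ 0 := by
  cases g
  · simp only [geodesic, halfSpace, tform, mem_ofPred_eq, inner_add_left, real_inner_smul_left]
    rw [add_le_iff_nonpos_right, mul_nonpos_iff_pos_imp_nonpos]
    simp [ht, ht.le]
  · have hst := Real.sin_pos_of_pos_of_lt_pi ht (hpi rfl)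
    simp only [geodesic, halfSpace, tform, mem_ofPred_eq, inner_add_left, real_inner_smul_left,
      hv.1, mul_zero, zero_add]
    exact ⟨fun h => by nlinarith, fun h => by nlinarith⟩
  · have hst := Real.sinh_pos_iff.2 ht
    simp only [geodesic, halfSpace, tform, mem_ofPred_eq, lorentz_add_left, lorentz_smul_left,
      hv.1, mul_zero, zero_add, ← mul_neg]
    exact ⟨fun h => by nlinarith, fun h => by nlinarith⟩

/-! ### Compactness and convexity of balls. -/

theorem isClosed_gball (z : Space g n) (r : ℝ) : IsClosed (gball z r) :=
  isClosed_le (continuous_gdist.comp (by fun_prop : Continuous fun x => (x, z)))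
    continuous_const

theorem isClosed_carrier : IsClosed (carrier g n) := by
  cases g
  · exact isClosed_univ
  · exact isClosed_eq (by fun_prop : Continuous
      fun x : EuclideanSpace ℝ (Fin (n + 1)) => (inner ℝ x x : ℝ)) continuous_const
  · exact (isClosed_eq (continuous_lorentz.comp (by fun_prop : Continuous
      fun x : EuclideanSpace ℝ (Fin (n + 1)) => (x, x))) continuous_const).inter
      (isClosed_le continuous_const (by fun_prop : Continuous
        fun x : EuclideanSpace ℝ (Fin (n + 1)) => x 0))

/-- In `Hⁿ`, let `S < z₀` be the norm of the spatial part of `z`. Cauchy–Schwarz gives `x₀ (z₀ - S)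
≤ 𝓑(x, z) ≤ cosh r`, and `‖x‖² = 2 x₀² - 1`. -/
theorem exists_norm_le_of_mem_gball (z : Space g n) (r : ℝ) :
    ∃ M, ∀ x ∈ gball z r, ‖x.1‖ ≤ M := by
  cases g
  · refine ⟨r + ‖z.1‖, fun x hx => ?_⟩
    have h1 : ‖x.1 - z.1‖ ≤ r := hx
    have h2 := norm_le_norm_sub_add x.1 z.1
    linarith
  · exact ⟨1, fun x _ => (norm_eq_one_of_spherical x).le⟩
  · set S := √(z.1 0 ^ 2 - 1) with hS
    have hz : lorentz (n := n) z.1 z.1 = 1 := z.2.1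
    have hz0 : 1 ≤ z.1 0 := z.2.2
    have hSz : S < z.1 0 := by
      rw [hS, Real.sqrt_lt' (by linarith)]; linarith
    refine ⟨√(2 * (Real.cosh r / (z.1 0 - S)) ^ 2), fun x hx => Real.le_sqrt_of_sq_le ?_⟩
    have hd : lorentz (n := n) x.1 z.1 ≤ Real.cosh r := by
      rw [← cosh_gdist, Real.cosh_le_cosh, abs_of_nonneg (gdist_nonneg _ _)]
      exact le_trans hx (le_abs_self r)
    have hxx : lorentz (n := n) x.1 x.1 = 1 := x.2.1
    have hx0 : 1 ≤ x.1 0 := x.2.2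
    have hcs := Finset.sum_mul_sq_le_sq_mul_sq Finset.univ (fun i : Fin n => x.1 i.succ)
      (fun i : Fin n => z.1 i.succ)
    rw [EuclideanSpace.norm_sq_eq]
    change ∑ i : Fin (n + 1), ‖x.1 i‖ ^ 2 ≤ _
    rw [Fin.sum_univ_succ]
    simp only [Real.norm_eq_abs, sq_abs]
    simp only [lorentz, ← pow_two] at hz hxx hd
    have e1 : ∑ i : Fin n, x.1 i.succ ^ 2 = x.1 0 ^ 2 - 1 := by linarith
    have e2 : ∑ i : Fin n, z.1 i.succ ^ 2 = z.1 0 ^ 2 - 1 := by linarith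
    have hSsq : S ^ 2 = z.1 0 ^ 2 - 1 := Real.sq_sqrt (by nlinarith)
    have hS0 : 0 ≤ S := Real.sqrt_nonneg _
    rw [e1, e2, ← hSsq] at hcs
    have h3 : ∑ i : Fin n, x.1 i.succ * z.1 i.succ ≤ x.1 0 * S := by
      refine le_of_sq_le_sq (hcs.trans ?_) (by positivity)
      nlinarith [sq_nonneg S]
    have h4 : x.1 0 ≤ Real.cosh r / (z.1 0 - S) := by
      rw [le_div_iff₀ (by linarith)]
      linarith
    rw [e1]
    have h5 := pow_le_pow_left₀ (by linarith) h4 2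
    linarith

theorem isCompact_gball (z : Space g n) (r : ℝ) : IsCompact (gball z r) := by
  obtain ⟨M, hM⟩ := exists_norm_le_of_mem_gball z r
  have h := (isClosed_carrier (g := g) (n := n)).isClosedEmbedding_subtypeVal.isCompact_preimage
    (isCompact_closedBall (0 : Ambient g n) M)
  exact h.of_isClosed_subset (isClosed_gball z r) fun x hx => by simpa using hM x hx

/-- On `Sⁿ`, `sin t ⟨w, z⟩ = sin (t - s) ⟨x, z⟩ + sin s ⟨y, z⟩`. Subadditivity of the sine together
with `cos r > 0`, which is where `r < π / 2` enters, gives `⟨w, z⟩ ≥ cos r`. In `Hⁿ` the argument is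
the same with superadditivity of `sinh`. -/
theorem gsegment_subset_gball {z x y : Space g n} {r : ℝ}
    (hr : g = .spherical → r < Real.pi / 2) (hx : x ∈ gball z r) (hy : y ∈ gball z r) :
    gsegment x y ⊆ gball z r := by
  rintro w ⟨v, t, hv, ht, htpi, hyt, s, ⟨hs0, hst⟩, hw⟩
  have hr0 : 0 ≤ r := (gdist_nonneg _ _).trans hx
  rcases ht.eq_or_lt with rfl | ht
  · have : s = 0 := le_antisymm hst hs0
    rw [this, geodesic_zero] at hw
    rwa [Subtype.ext hw]
  cases g
  · have h1 : ‖x.1 - z.1‖ ≤ r := hx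
    have h2 : ‖y.1 - z.1‖ ≤ r := hy
    have e : w.1 - z.1 = (1 - s / t) • (x.1 - z.1) + (s / t) • (y.1 - z.1) := by
      rw [hw, hyt]
      simp only [geodesic]
      have : s • v = (s / t) • (t • v) := by rw [smul_smul, div_mul_cancel₀ _ ht.ne']
      rw [this]
      module
    have h3 : s / t ≤ 1 := (div_le_one ht).2 hst
    have h4 : 0 ≤ s / t := by positivity
    change ‖w.1 - z.1‖ ≤ r
    rw [e]
    refine (norm_add_le _ _).trans ?_
    rw [norm_smul, norm_smul, Real.norm_of_nonneg h4, Real.norm_of_nonneg (sub_nonneg.2 h3)]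
    nlinarith
  · have hsin := Real.sin_pos_of_pos_of_lt_pi ht (htpi rfl)
    have hr2 := hr rfl
    have hmem : ∀ u : Space .spherical n, u ∈ gball z r ↔ Real.cos r ≤ inner ℝ u.1 z.1 := by
      intro u
      rw [← cos_gdist]
      exact (Real.strictAntiOn_cos.le_iff_ge ⟨hr0, by linarith [Real.pi_pos]⟩
        ⟨gdist_nonneg _ _, gdist_le_pi _ _⟩).symm
    rw [hmem] at hx hy ⊢
    have e : Real.sin t * inner ℝ w.1 z.1 =
        Real.sin (t - s) * inner ℝ x.1 z.1 + Real.sin s * inner ℝ y.1 z.1 := by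
      rw [hw, hyt]
      simp only [geodesic, inner_add_left, real_inner_smul_left, Real.sin_sub]
      ring
    have hs1 : 0 ≤ Real.sin s := Real.sin_nonneg_of_nonneg_of_le_pi hs0 (by linarith [htpi rfl])
    have hs2 : 0 ≤ Real.sin (t - s) :=
      Real.sin_nonneg_of_nonneg_of_le_pi (by linarith) (by linarith [htpi rfl])
    have hsub : Real.sin t ≤ Real.sin (t - s) + Real.sin s := by
      have h1 : Real.sin t = Real.sin (t - s) * Real.cos s + Real.cos (t - s) * Real.sin s := by
        rw [← Real.sin_add, sub_add_cancel]
      rw [h1]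
      nlinarith [Real.cos_le_one s, Real.cos_le_one (t - s)]
    have hcos : 0 < Real.cos r := Real.cos_pos_of_mem_Ioo ⟨by linarith, hr2⟩
    refine le_of_mul_le_mul_left ?_ hsin
    rw [e]
    nlinarith
  · have hsin := Real.sinh_pos_iff.2 ht
    have hmem : ∀ u : Space .hyperbolic n,
        u ∈ gball z r ↔ lorentz (n := n) u.1 z.1 ≤ Real.cosh r := by
      intro u
      rw [← cosh_gdist, Real.cosh_le_cosh, abs_of_nonneg (gdist_nonneg _ _), abs_of_nonneg hr0]
      rfl
    rw [hmem] at hx hy ⊢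
    have e : Real.sinh t * lorentz (n := n) w.1 z.1 =
        Real.sinh (t - s) * lorentz (n := n) x.1 z.1 +
          Real.sinh s * lorentz (n := n) y.1 z.1 := by
      rw [hw, hyt]
      simp only [geodesic, lorentz_add_left, lorentz_smul_left, Real.sinh_sub]
      ring
    have hs1 : 0 ≤ Real.sinh s := Real.sinh_nonneg_iff.2 hs0
    have hs2 : 0 ≤ Real.sinh (t - s) := Real.sinh_nonneg_iff.2 (sub_nonneg.2 hst)
    have hsub : Real.sinh (t - s) + Real.sinh s ≤ Real.sinh t := by
      have h1 : Real.sinh t =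
          Real.sinh (t - s) * Real.cosh s + Real.cosh (t - s) * Real.sinh s := by
        rw [← Real.sinh_add, sub_add_cancel]
      rw [h1]
      nlinarith [Real.one_le_cosh s, Real.one_le_cosh (t - s)]
    have hcos : 0 < Real.cosh r := Real.cosh_pos r
    refine le_of_mul_le_mul_left ?_ hsin
    rw [e]
    nlinarith

theorem inOpenHemisphere_of_subset_gball {X : Set (Space g n)} {z : Space g n} {r : ℝ}
    (hr : g = .spherical → r < Real.pi / 2) (hX : X ⊆ gball z r) : InOpenHemisphere g n X := by
  cases g
  · trivial
  · refine ⟨z.1, fun x hx => ?_⟩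
    have h : gdist x z < Real.pi / 2 := lt_of_le_of_lt (hX hx) (hr rfl)
    rw [real_inner_comm, ← cos_gdist]
    exact Real.cos_pos_of_mem_Ioo ⟨by linarith [gdist_nonneg x z, Real.pi_pos], h⟩
  · trivial

/-- Distance `π` means antipodal, and no open hemisphere contains an antipodal pair. -/
theorem InOpenHemisphere.gdist_lt_pi {X : Set (Space .spherical n)}
    (hX : InOpenHemisphere .spherical n X) {x y : Space .spherical n} (hx : x ∈ X) (hy : y ∈ X) :
    gdist x y < Real.pi := by
  obtain ⟨u, hu⟩ := hX
  refine lt_of_le_of_ne (gdist_le_pi _ _) fun h => ?_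
  have h1 := cos_gdist x y
  rw [h, Real.cos_pi] at h1
  have h2 := (inner_eq_neg_one_iff_of_norm_eq_one (𝕜 := ℝ) (norm_eq_one_of_spherical x)
    (norm_eq_one_of_spherical y)).1 h1.symm
  have h3 := hu x hx
  have h4 := hu y hy
  rw [h2, inner_neg_right] at h3
  linarith

/-! ### Nearest points and exterior normals. -/

theorem mem_halfSpace_self {p : Space g n} {v : Ambient g n} (hv : IsUnitTangentAt g n p.1 v) :
    p.1 ∈ halfSpace g n p.1 v := by
  cases g
  · exact (le_rfl : (inner ℝ p.1 v : ℝ) ≤ inner ℝ p.1 v)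
  · exact hv.1.le
  · exact (neg_eq_zero.2 hv.1).le

theorem continuous_geoPoint (p : Space g n) {v : Ambient g n} (hv : IsUnitTangentAt g n p.1 v) :
    Continuous (geoPoint p v hv) :=
  (continuous_geodesic _ _).subtype_mk _

theorem geoPoint_mem_gsegment {p : Space g n} {v : Ambient g n}
    (hv : IsUnitTangentAt g n p.1 v) {s t : ℝ} (hs : 0 ≤ s) (hst : s ≤ t)
    (hpi : g = .spherical → t < Real.pi) :
    geoPoint p v hv s ∈ gsegment p (geoPoint p v hv t) :=
  ⟨v, t, hv, hs.trans hst, hpi, rfl, s, ⟨hs, hst⟩, rfl⟩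

theorem geoPoint_velocity (p : Space g n) {v : Ambient g n} (hv : IsUnitTangentAt g n p.1 v)
    (s t : ℝ) : geoPoint (geoPoint p v hv s) (velocity g n p.1 v s)
      (isUnitTangentAt_velocity p hv s) t = geoPoint p v hv (s + t) :=
  Subtype.ext (geodesic_geodesic _ _ _ _)

theorem geoPoint_neg (p : Space g n) {v : Ambient g n} (hv : IsUnitTangentAt g n p.1 v) (t : ℝ) :
    geoPoint p (-v) hv.neg t = geoPoint p v hv (-t) :=
  Subtype.ext (geodesic_neg _ _ _)

/-- A geodesic that minimises the distance to a convex set leaves it in a normal direction. -/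
theorem isOuterUnitNormal_of_forall_le (hn : 2 ≤ n) {K : Set (Space g n)} (hK : IsConvexSet K)
    {p : Space g n} (hp : p ∈ K) {v : Ambient g n} (hv : IsUnitTangentAt g n p.1 v) {t : ℝ}
    (ht : 0 < t) (hpi : g = .spherical → t < Real.pi)
    (hmin : ∀ x ∈ K, t ≤ gdist x (geoPoint p v hv t)) : IsOuterUnitNormal K p v := by
  refine ⟨hv, fun x hx => ?_⟩
  obtain ⟨w, hw, hxw⟩ := exists_geoPoint hn p x
  rcases (gdist_nonneg p x).eq_or_lt with h0 | h0
  · rw [← h0, geoPoint_zero] at hxw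
    rw [hxw]
    exact mem_halfSpace_self hv
  have hd : g = .spherical → gdist p x < Real.pi := by
    rintro rfl
    exact hK.2.gdist_lt_pi hp hx
  -- If `x` were outside the half-space, the direction to `x` would be acute with `v`. The start of
  -- `[p, x]`, which lies in `K`, would then come closer to the end of the geodesic than `p`.
  by_contra hnot
  rw [hxw] at hnot
  have hc := lt_of_not_ge (mt (geodesic_mem_halfSpace_iff hv h0 hd).2 hnot)
  obtain ⟨s, hs1, hs0, hs2⟩ := ((eventually_gdist_lt hv hw hc ht hpi).and
    (Ioo_mem_nhdsGT h0)).exists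
  refine absurd (hmin (geoPoint p w hw s) (hK.1 p hp x hx ?_)) hs1.not_ge
  have h := geoPoint_mem_gsegment hw hs0.le hs2.le hd
  rwa [← hxw] at h

/-- From an interior point a short move along `v` would stay in `K` and shorten the distance. -/
theorem mem_frontier_of_forall_le {K : Set (Space g n)} {p : Space g n} (hp : p ∈ K)
    {v : Ambient g n} (hv : IsUnitTangentAt g n p.1 v) {t : ℝ}
    (ht : 0 < t) (hpi : g = .spherical → t < Real.pi)
    (hmin : ∀ x ∈ K, t ≤ gdist x (geoPoint p v hv t)) : p ∈ frontier K := by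
  refine ⟨subset_closure hp, fun hint => ?_⟩
  have h1 : Tendsto (geoPoint p v hv) (𝓝[>] 0) (𝓝 p) := by
    have h := ((continuous_geoPoint p hv).tendsto 0).mono_left
      (nhdsWithin_le_nhds : 𝓝[>] (0 : ℝ) ≤ 𝓝 0)
    rwa [geoPoint_zero] at h
  obtain ⟨s, hs1, hs0, hs2⟩ := ((h1.eventually (mem_interior_iff_mem_nhds.1 hint)).and
    (Ioo_mem_nhdsGT ht)).exists
  have h2 := hmin _ hs1
  rw [gdist_geoPoint p hv hs2.le fun h => by linarith [hpi h]] at h2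
  linarith

/-- If a ball lies in a half-space whose boundary touches it at `p`, its centre lies on the
geodesic normal to the boundary at `p`. -/
theorem eq_geoPoint_of_gball_subset (hn : 2 ≤ n) {p q : Space g n} {v : Ambient g n}
    (hv : IsUnitTangentAt g n p.1 v) (hpos : 0 < gdist p q)
    (hpi : g = .spherical → gdist p q < Real.pi)
    (h : ∀ x ∈ gball q (gdist p q), x.1 ∈ halfSpace g n p.1 v) :
    q = geoPoint p (-v) hv.neg (gdist p q) := by
  obtain ⟨w, hw, hq⟩ := exists_geoPoint hn p q
  by_cases hwv : w = -v
  · subst hwv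
    exact hq
  -- Moving from `p` along `u` enters the ball about `q` and at the same time leaves the half-space.
  · obtain ⟨u, hu, huv, huw⟩ := exists_acute hv hw hwv
    obtain ⟨s, hs1, hs0, hs2⟩ := ((eventually_gdist_lt hw hu huw hpos hpi).and
      (Ioo_mem_nhdsGT hpos)).exists
    rw [← hq] at hs1
    have h1 := (geodesic_mem_halfSpace_iff hv hs0 fun e => hs2.trans (hpi e)).1
      (h (geoPoint p u hu s) hs1.le)
    exact absurd huv h1.not_gt

/-! ### Prolongation, inclusion of balls, extremal distances. -/

/-- Prolongation of a geodesic segment. -/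
theorem exists_prolongation (hn : 2 ≤ n) (x y : Space g n) {r : ℝ} (hr : 0 ≤ r)
    (hpi : g = .spherical → gdist x y + r ≤ Real.pi) :
    ∃ z, gdist x z = gdist x y + r ∧ gdist y z = r := by
  obtain ⟨v, hv, hy⟩ := exists_geoPoint hn x y
  have h0 := gdist_nonneg x y
  refine ⟨geoPoint x v hv (gdist x y + r),
    gdist_geoPoint_right x hv (add_nonneg h0 hr) hpi, ?_⟩
  have h := gdist_geoPoint x hv (le_add_of_nonneg_right hr : gdist x y ≤ gdist x y + r)
    fun e => by linarith [hpi e]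
  rw [← hy] at h
  rw [h]
  ring

theorem exists_between (hn : 2 ≤ n) {x z : Space g n} {a b : ℝ} (ha : 0 ≤ a) (hb : 0 ≤ b)
    (h : gdist x z ≤ a + b) : ∃ y, gdist x y ≤ a ∧ gdist y z ≤ b := by
  rcases le_or_gt (gdist x z) a with h1 | h1
  · exact ⟨z, h1, by rwa [gdist_self]⟩
  · obtain ⟨v, hv, hz⟩ := exists_geoPoint hn x z
    have hpi : g = .spherical → gdist x z ≤ Real.pi := by
      rintro rfl
      exact gdist_le_pi _ _
    refine ⟨geoPoint x v hv a, (gdist_geoPoint_right x hv ha fun e => h1.le.trans (hpi e)).le, ?_⟩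
    have h2 := gdist_geoPoint x hv h1.le fun e => by linarith [hpi e]
    rw [← hz] at h2
    linarith

/-- If all points of the ball `B(z, r)` have distance at most `s < π` to `x`, then
`d(x, z) + r ≤ s`. -/
theorem gdist_add_le_of_gball_subset (hn : 2 ≤ n) {x z : Space g n} {r s : ℝ} (hr : 0 ≤ r)
    (hs : g = .spherical → s < Real.pi) (h : gball z r ⊆ gball x s) : gdist x z + r ≤ s := by
  by_cases hpi : g = .spherical → gdist x z + r ≤ Real.pi
  · obtain ⟨y, hy1, hy2⟩ := exists_prolongation hn x z hr hpi
    rw [← hy1, gdist_comm]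
    exact h (show gdist y z ≤ r by rw [gdist_comm, hy2])
  -- Here the ball contains the antipode of `x`, at distance `π > s`.
  · push Not at hpi
    obtain ⟨rfl, hlt⟩ := hpi
    obtain ⟨y, hy1, hy2⟩ := exists_prolongation hn x z (r := Real.pi - gdist x z)
      (sub_nonneg.2 (gdist_le_pi _ _)) (fun _ => by linarith)
    have h1 : gdist y x ≤ s := h (show gdist y z ≤ r by rw [gdist_comm, hy2]; linarith)
    rw [gdist_comm, hy1] at h1
    linarith [hs rfl]

theorem bddAbove_gdist {K : Set (Space g n)} (hK : IsCompact K) :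
    BddAbove {d | ∃ x ∈ K, ∃ y ∈ K, d = gdist x y} := by
  obtain ⟨M, hM⟩ := ((hK.prod hK).image (continuous_gdist (g := g) (n := n))).bddAbove
  exact ⟨M, by rintro _ ⟨x, hx, y, hy, rfl⟩; exact hM ⟨(x, y), ⟨hx, hy⟩, rfl⟩⟩

theorem gdist_le_gdiam {K : Set (Space g n)} (hK : IsCompact K) {x y : Space g n} (hx : x ∈ K)
    (hy : y ∈ K) : gdist x y ≤ gdiam K :=
  le_csSup (bddAbove_gdist hK) ⟨x, hx, y, hy, rfl⟩

theorem exists_gdist_eq_gdiam {K : Set (Space g n)} (hK : IsCompact K) (hne : K.Nonempty) :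
    ∃ x ∈ K, ∃ y ∈ K, gdist x y = gdiam K := by
  obtain ⟨⟨x, y⟩, ⟨hx, hy⟩, hmax⟩ := (hK.prod hK).exists_isMaxOn (hne.prod hne)
    (continuous_gdist (g := g) (n := n)).continuousOn
  refine ⟨x, hx, y, hy, le_antisymm (gdist_le_gdiam hK hx hy) ?_⟩
  refine csSup_le ⟨_, x, hx, y, hy, rfl⟩ ?_
  rintro _ ⟨a, ha, b, hb, rfl⟩
  exact hmax (show (a, b) ∈ K ×ˢ K from ⟨ha, hb⟩)

theorem exists_nearest {K : Set (Space g n)} (hK : IsCompact K) (hne : K.Nonempty)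
    (z : Space g n) : ∃ p ∈ K, ∀ x ∈ K, gdist p z ≤ gdist x z :=
  hK.exists_isMinOn hne
    (continuous_gdist.comp (by fun_prop : Continuous fun x => (x, z))).continuousOn

theorem IsConvexBody.nonempty {K : Set (Space g n)} (hK : IsConvexBody K) : K.Nonempty :=
  hK.2.2.mono interior_subset

/-! ### Constant width and intersections of balls. -/

namespace IsConvexBodyOfConstantWidth

variable {K : Set (Space g n)} {D : ℝ}

theorem gdist_le (hK : IsConvexBodyOfConstantWidth K D) {x y : Space g n} (hx : x ∈ K)
    (hy : y ∈ K) : gdist x y ≤ D :=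
  (gdist_le_gdiam hK.1.1 hx hy).trans hK.2.1.le

/-- The segment of length `D` that starts at the point of `K` nearest to an exterior point and
leads away from that point. -/
theorem geoPoint_neg_mem (hn : 2 ≤ n) (hK : IsConvexBodyOfConstantWidth K D) {p : Space g n}
    (hp : p ∈ K) {v : Ambient g n} (hv : IsUnitTangentAt g n p.1 v) {t : ℝ}
    (ht : 0 < t) (hpi : g = .spherical → t < Real.pi)
    (hmin : ∀ x ∈ K, t ≤ gdist x (geoPoint p v hv t)) {s : ℝ} (hs0 : 0 ≤ s) (hs : s ≤ D) :
    geoPoint p v hv (-s) ∈ K := by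
  obtain ⟨q, hq, hqv⟩ := hK.2.2 p (mem_frontier_of_forall_le hp hv ht hpi hmin) v
    (isOuterUnitNormal_of_forall_le hn hK.1.2.1 hp hv ht hpi hmin) s ⟨hs0, hs⟩
  rwa [← geoPoint_neg, ← (Subtype.ext hqv : q = geoPoint p (-v) hv.neg s)]

/-- The geodesic from `z` through its nearest point `p` continues in `K` for length `D`. Its total
length `d(p, z) + D ≤ 2 D + σ` is below `π` on the sphere, so it is still minimising and its end is
at distance `d(p, z) + D ≤ D + σ` from `z`. -/
theorem exists_gdist_le (hn : 2 ≤ n) (hD : 0 < D) (hK : IsConvexBodyOfConstantWidth K D)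
    {σ : ℝ} (hσ : 0 ≤ σ) (hpi : g = .spherical → 2 * D + σ < Real.pi) {z : Space g n}
    (hz : ∀ x ∈ K, gdist x z ≤ D + σ) : ∃ p ∈ K, gdist p z ≤ σ := by
  obtain ⟨p, hp, hmin⟩ := exists_nearest hK.1.1 hK.1.nonempty z
  refine ⟨p, hp, ?_⟩
  rcases (gdist_nonneg p z).eq_or_lt with h0 | h0
  · rwa [← h0]
  obtain ⟨v, hv, hzv⟩ := exists_geoPoint hn p z
  have hpz := hz p hp
  have hq := hK.geoPoint_neg_mem hn hp hv h0 (fun e => by linarith [hpi e])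
    (by rw [← hzv]; exact hmin) hD.le le_rfl
  have h1 := gdist_geoPoint p hv (by linarith : -D ≤ gdist p z) fun e => by linarith [hpi e]
  have h2 := hz _ hq
  rw [← hzv] at h1
  linarith

theorem parallel_eq_iInter (hn : 2 ≤ n) (hD : 0 < D) (hK : IsConvexBodyOfConstantWidth K D)
    {σ : ℝ} (hσ : 0 ≤ σ) (hpi : g = .spherical → 2 * D + σ < Real.pi) :
    parallel K σ = ⋂ x ∈ K, gball x (D + σ) := by
  ext z
  simp only [mem_iInter]
  constructor
  · rintro ⟨y, hy, hyz⟩ x hx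
    change gdist z x ≤ D + σ
    rw [gdist_comm]
    exact (gdist_triangle hn x y z).trans (add_le_add (hK.gdist_le hx hy) hyz)
  · exact fun h => hK.exists_gdist_le hn hD hσ hpi fun x hx => (gdist_comm x z).trans_le (h x hx)

end IsConvexBodyOfConstantWidth

/-! ### Parallel domains and their diameter. -/

theorem subset_parallel (K : Set (Space g n)) {ρ : ℝ} (hρ : 0 ≤ ρ) : K ⊆ parallel K ρ :=
  fun x hx => ⟨x, hx, by rwa [gdist_self]⟩

theorem parallel_zero (hn : 2 ≤ n) (K : Set (Space g n)) : parallel K 0 = K := by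
  refine Subset.antisymm ?_ (subset_parallel K le_rfl)
  rintro z ⟨x, hx, hxz⟩
  rwa [← eq_of_gdist_eq_zero hn (le_antisymm hxz (gdist_nonneg _ _))]

/-- A boundary point of the parallel domain has distance `ρ` from its nearest point. -/
theorem le_gdist_of_mem_frontier_parallel {K : Set (Space g n)} {ρ : ℝ} {p q : Space g n}
    (hq : q ∈ K) (hp : p ∈ frontier (parallel K ρ)) : ρ ≤ gdist q p := by
  by_contra hlt
  refine hp.2 (mem_interior.2 ⟨{z | gdist q z < ρ}, fun z hz => ⟨q, hq, le_of_lt hz⟩, ?_,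
    not_le.1 hlt⟩)
  exact isOpen_lt (continuous_gdist.comp (by fun_prop : Continuous fun z => (q, z)))
    continuous_const

/-- A diametral segment prolonged by `ρ` at both ends attains the bound given by the triangle
inequality. -/
theorem gdiam_parallel (hn : 2 ≤ n) {K : Set (Space g n)} (hK : IsCompact K) (hne : K.Nonempty)
    {ρ : ℝ} (hρ : 0 ≤ ρ) (hpi : g = .spherical → gdiam K + 2 * ρ ≤ Real.pi) :
    gdiam (parallel K ρ) = gdiam K + 2 * ρ := by
  have hle : ∀ d ∈ {d | ∃ x ∈ parallel K ρ, ∃ y ∈ parallel K ρ, d = gdist x y},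
      d ≤ gdiam K + 2 * ρ := by
    rintro _ ⟨x, ⟨x', hx', hxx⟩, y, ⟨y', hy', hyy⟩, rfl⟩
    have h1 := gdist_triangle hn x x' y
    have h2 := gdist_triangle hn x' y' y
    have h3 := gdist_le_gdiam hK hx' hy'
    rw [gdist_comm x x'] at h1
    linarith
  obtain ⟨x, hx, y, hy, hxy⟩ := exists_gdist_eq_gdiam hK hne
  obtain ⟨y', hy1, hy2⟩ := exists_prolongation hn x y hρ
    fun e => by linarith [hpi e]
  obtain ⟨x', hx1, hx2⟩ := exists_prolongation hn y' x hρ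
    fun e => by rw [gdist_comm]; linarith [hpi e]
  refine le_antisymm (csSup_le ⟨_, x', ⟨x, hx, hx2.le⟩, y', ⟨y, hy, hy2.le⟩, rfl⟩ hle)
    (le_csSup ⟨_, hle⟩ ⟨y', ⟨y, hy, hy2.le⟩, x', ⟨x, hx, hx2.le⟩, ?_⟩)
  rw [hx1, gdist_comm, hy1, hxy]
  ring

/-! ### Width, circumradius and inradius of the parallel domain. -/

namespace IsConvexBodyOfConstantWidth

variable {K : Set (Space g n)} {D ρ : ℝ}

theorem isConvexBody_parallel (hn : 2 ≤ n) (hD : 0 < D) (hρ : 0 < ρ)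
    (hpi : g = .spherical → D + 2 * ρ < Real.pi / 2) (hK : IsConvexBodyOfConstantWidth K D) :
    IsConvexBody (parallel K ρ) := by
  have hr : g = .spherical → D + ρ < Real.pi / 2 := fun e => by linarith [hpi e]
  have heq := hK.parallel_eq_iInter hn hD hρ.le fun e => by linarith [hpi e]
  have hsub : ∀ x ∈ K, parallel K ρ ⊆ gball x (D + ρ) := fun x hx => by
    rw [heq]; exact biInter_subset_of_mem hx
  obtain ⟨x₀, hx₀⟩ := hK.1.nonempty
  refine ⟨(isCompact_gball x₀ (D + ρ)).of_isClosed_subset ?_ (hsub x₀ hx₀), ⟨?_,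
    inOpenHemisphere_of_subset_gball hr (hsub x₀ hx₀)⟩,
    hK.1.2.2.mono (interior_mono (subset_parallel K hρ.le))⟩
  · rw [heq]
    exact isClosed_biInter fun x _ => isClosed_gball x _
  · intro y hy z hz
    rw [heq]
    exact subset_iInter₂ fun x hx => gsegment_subset_gball hr (hsub x hx hy) (hsub x hx hz)

theorem parallel (hn : 2 ≤ n) (hD : 0 < D) (hρ : 0 < ρ)
    (hpi : g = .spherical → D + 2 * ρ < Real.pi / 2) (hK : IsConvexBodyOfConstantWidth K D) :
    IsConvexBodyOfConstantWidth (parallel K ρ) (D + 2 * ρ) := by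
  have hbody := hK.isConvexBody_parallel hn hD hρ hpi
  refine ⟨hbody, ?_, ?_⟩
  · rw [gdiam_parallel hn hK.1.1 hK.1.nonempty hρ.le, hK.2.1]
    intro e
    rw [hK.2.1]
    linarith [hpi e, Real.pi_pos]
  intro p hp v hv t ⟨ht0, ht⟩
  obtain ⟨q, hq, hmin⟩ := exists_nearest hK.1.1 hK.1.nonempty p
  obtain ⟨x, hx, hxp⟩ : p ∈ ConstantWidth.parallel K ρ := hbody.1.isClosed.frontier_subset hp
  have hqp : gdist p q = ρ := by
    rw [gdist_comm]
    exact le_antisymm ((hmin x hx).trans hxp) (le_gdist_of_mem_frontier_parallel hq hp)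
  have hρpi : g = .spherical → ρ < Real.pi := fun e => by linarith [hpi e, Real.pi_pos]
  obtain ⟨w, hw, hwv⟩ : ∃ w, ∃ hw : IsUnitTangentAt g n p.1 w, w = -v := ⟨_, hv.1.neg, rfl⟩
  have hqw : q = geoPoint p w hw ρ := by
    have h := eq_geoPoint_of_gball_subset hn hv.1 (by rwa [hqp]) (by rwa [hqp])
      (fun y hy => hv.2 y ⟨q, hq, by rw [gdist_comm, ← hqp]; exact hy⟩)
    subst hwv
    rwa [hqp] at h
  have hu := isUnitTangentAt_velocity p hw ρ
  have hseg : ∀ s, 0 ≤ s → s ≤ D → geoPoint p w hw (ρ + s) ∈ K := by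
    intro s hs0 hs
    -- Seen from `q`, the reversed normal reaches `p` at time `ρ`; so `p` is the exterior point
    -- whose nearest point in `K` is `q`.
    have hback : geoPoint (geoPoint p w hw ρ) (-velocity g n p.1 w ρ) hu.neg ρ = p := by
      rw [geoPoint_neg (geoPoint p w hw ρ) hu, geoPoint_velocity, add_neg_cancel, geoPoint_zero]
    have h := hK.geoPoint_neg_mem hn (hqw ▸ hq) hu.neg hρ hρpi
      (fun x hx => by rw [hback, ← hqp, gdist_comm]; exact hmin x hx) hs0 hs
    rwa [geoPoint_neg (geoPoint p w hw ρ) hu, neg_neg, geoPoint_velocity] at h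
  refine ⟨geoPoint p w hw t, ?_, by rw [← hwv]; rfl⟩
  -- Three stretches: within `ρ` of `q`, then inside `K` for length `D`, then within `ρ` of the
  -- endpoint in `K`.
  rcases le_total t ρ with h1 | h1
  · refine ⟨q, hq, ?_⟩
    rw [gdist_comm, hqw, gdist_geoPoint p hw h1 fun e => by linarith [hρpi e]]
    linarith
  rcases le_total t (ρ + D) with h2 | h2
  · refine subset_parallel K hρ.le ?_
    have h := hseg (t - ρ) (by linarith) (by linarith)
    rwa [add_sub_cancel] at h
  · refine ⟨_, hseg D hD.le le_rfl, ?_⟩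
    rw [gdist_geoPoint p hw h2 fun e => by linarith [hρpi e]]
    linarith

/-- A ball `B(z, r)` with `r < π` on the sphere contains the parallel domain only if `B(z, r - ρ)`
contains `K`; the converse is the triangle inequality. -/
theorem circumradius_parallel (hn : 2 ≤ n) (hD : 0 < D) (hρ : 0 < ρ)
    (hpi : g = .spherical → D + 2 * ρ < Real.pi / 2) (hK : IsConvexBodyOfConstantWidth K D) :
    circumradius (ConstantWidth.parallel K ρ) = circumradius K + ρ := by
  obtain ⟨x₀, hx₀⟩ := hK.1.nonempty
  have hDmem : D ∈ {r | 0 ≤ r ∧ ∃ z : Space g n, K ⊆ gball z r} :=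
    ⟨hD.le, x₀, fun x hx => hK.gdist_le hx hx₀⟩
  have hup : ∀ r ∈ {r | 0 ≤ r ∧ ∃ z : Space g n, K ⊆ gball z r},
      r + ρ ∈ {r | 0 ≤ r ∧ ∃ z : Space g n, ConstantWidth.parallel K ρ ⊆ gball z r} := by
    rintro r ⟨hr, z, hz⟩
    refine ⟨by linarith, z, ?_⟩
    rintro y ⟨x, hx, hxy⟩
    have h1 : gdist x z ≤ r := hz hx
    have h2 := gdist_triangle hn y x z
    rw [gdist_comm y x] at h2
    exact show gdist y z ≤ r + ρ by linarith
  have hbdd : ∀ A : ℝ → Prop, BddBelow {r : ℝ | 0 ≤ r ∧ A r} := fun A => ⟨0, fun r hr => hr.1⟩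
  refine le_antisymm ?_ (le_csInf ⟨_, hup D hDmem⟩ ?_)
  · rw [← sub_le_iff_le_add]
    refine le_csInf ⟨D, hDmem⟩ fun r hr => ?_
    rw [sub_le_iff_le_add]
    exact csInf_le (hbdd _) (hup r hr)
  · rintro r ⟨hr, z, hz⟩
    by_cases hrpi : g = .spherical → r < Real.pi
    · have hx : ∀ x ∈ K, gdist z x + ρ ≤ r := fun x hx =>
        gdist_add_le_of_gball_subset hn hρ.le hrpi
          fun y hy => hz ⟨x, hx, (gdist_comm x y).trans_le hy⟩
      rw [← le_sub_iff_add_le]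
      refine csInf_le (hbdd _) ⟨?_, z, fun x hxK => ?_⟩
      · linarith [hx x₀ hx₀, gdist_nonneg z x₀]
      · have := hx x hxK
        rw [gdist_comm] at this
        exact show gdist x z ≤ r - ρ by linarith
    -- For `r ≥ π` the spherical ball is everything, but `r` then exceeds `D + ρ ≥ R(K) + ρ`.
    · push Not at hrpi
      have h1 : circumradius K ≤ D := csInf_le (hbdd _) hDmem
      linarith [hpi hrpi.1, hrpi.2, Real.pi_pos]

theorem inradius_parallel (hn : 2 ≤ n) (hD : 0 < D) (hρ : 0 < ρ)
    (hpi : g = .spherical → D + 2 * ρ < Real.pi / 2) (hK : IsConvexBodyOfConstantWidth K D) :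
    inradius (ConstantWidth.parallel K ρ) = inradius K + ρ := by
  -- Used with `σ = ρ` for the comparison and, through `hbdd`, with both `σ = 0` and `σ = ρ` for
  -- boundedness of the radii.
  have hcap : ∀ σ, 0 ≤ σ → σ ≤ ρ → ∀ r, 0 ≤ r → ∀ z, gball z r ⊆ ConstantWidth.parallel K σ →
      ∀ x ∈ K, gdist x z + r ≤ D + σ := by
    intro σ hσ0 hσ r hr z hz x hx
    refine gdist_add_le_of_gball_subset hn hr (fun e => by linarith [hpi e, Real.pi_pos]) ?_
    rw [hK.parallel_eq_iInter hn hD hσ0 fun e => by linarith [hpi e]] at hz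
    exact hz.trans (biInter_subset_of_mem hx)
  obtain ⟨x₀, hx₀⟩ := hK.1.nonempty
  have hbdd : ∀ σ, 0 ≤ σ → σ ≤ ρ →
      BddAbove {r | 0 ≤ r ∧ ∃ z : Space g n, gball z r ⊆ ConstantWidth.parallel K σ} := by
    refine fun σ hσ0 hσ => ⟨D + σ, ?_⟩
    rintro r ⟨hr, z, hz⟩
    linarith [hcap σ hσ0 hσ r hr z hz x₀ hx₀, gdist_nonneg x₀ z]
  have hbdd0 := hbdd 0 le_rfl hρ.le
  rw [parallel_zero hn] at hbdd0
  have hzero : (0 : ℝ) ∈ {r | 0 ≤ r ∧ ∃ z : Space g n, gball z r ⊆ K} := by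
    refine ⟨le_rfl, x₀, fun y hy => ?_⟩
    rwa [eq_of_gdist_eq_zero hn (le_antisymm hy (gdist_nonneg _ _))]
  have hup : ∀ r ∈ {r | 0 ≤ r ∧ ∃ z : Space g n, gball z r ⊆ K},
      r + ρ ∈ {r | 0 ≤ r ∧ ∃ z : Space g n, gball z r ⊆ ConstantWidth.parallel K ρ} := by
    rintro r ⟨hr, z, hz⟩
    refine ⟨by linarith, z, fun y hy => ?_⟩
    obtain ⟨x, hzx, hxy⟩ := exists_between hn hr hρ.le ((gdist_comm z y).trans_le hy)
    exact ⟨x, hz ((gdist_comm x z).trans_le hzx), hxy⟩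
  refine le_antisymm (csSup_le ⟨_, hup 0 hzero⟩ ?_) ?_
  · rintro r ⟨hr, z, hz⟩
    -- For `r ≤ ρ` shrinking by `ρ` may leave no ball; `r(K) ≥ 0` suffices.
    rcases le_total r ρ with h | h
    · have h1 : 0 ≤ inradius K := le_csSup hbdd0 hzero
      linarith
    · rw [← sub_le_iff_le_add]
      refine le_csSup hbdd0 ⟨by linarith, z, fun y hy => ?_⟩
      -- With `K` as the intersection of the `B(x, D)`, it remains to add `d(y, z) ≤ r - ρ` and
      -- `d(x, z) ≤ D + ρ - r`.
      rw [← parallel_zero hn K, hK.parallel_eq_iInter hn hD le_rfl fun e => by linarith [hpi e]]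
      refine mem_iInter₂.2 fun x hx => ?_
      have h1 := hcap ρ hρ.le le_rfl r hr z hz x hx
      have h2 := gdist_triangle hn y z x
      have h3 : gdist y z ≤ r - ρ := hy
      rw [gdist_comm z x] at h2
      exact show gdist y x ≤ D + 0 by linarith
  · rw [← le_sub_iff_add_le]
    refine csSup_le ⟨0, hzero⟩ fun r hr => ?_
    rw [le_sub_iff_add_le]
    exact le_csSup (hbdd ρ hρ.le le_rfl) (hup r hr)

end IsConvexBodyOfConstantWidth

end ConstantWidth

theorem mainTheorem6 (g : ConstantWidth.Geometry) (n : ℕ) (hn : 2 ≤ n) (D ρ : ℝ)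
    (hD : 0 < D) (hρ : 0 < ρ)
    (hsph : g = ConstantWidth.Geometry.spherical → D + 2 * ρ < Real.pi / 2)
    (K : Set (ConstantWidth.Space g n))
    (hK : ConstantWidth.IsConvexBodyOfConstantWidth K D) :
    ConstantWidth.IsConvexBodyOfConstantWidth (ConstantWidth.parallel K ρ) (D + 2 * ρ) ∧
    ConstantWidth.circumradius (ConstantWidth.parallel K ρ) =
      ConstantWidth.circumradius K + ρ ∧
    ConstantWidth.inradius (ConstantWidth.parallel K ρ) = ConstantWidth.inradius K + ρ ∧
    ConstantWidth.parallel K ρ = ⋂ x ∈ K, ConstantWidth.gball x (D + ρ) :=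
  ⟨hK.parallel hn hD hρ hsph, hK.circumradius_parallel hn hD hρ hsph,
    hK.inradius_parallel hn hD hρ hsph,
    hK.parallel_eq_iInter hn hD hρ.le fun e => by linarith [hsph e]⟩
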